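/- Let $n\ge 3$ and let $K_n$ be the complete graph on $n$ vertices. Let $F_{K_n}=\sum_{T}\prod_{e\in E(T)}x_e$ be its Kirchhoff polynomial, where $T$ runs over the spanning trees of $K_n$ and there is one variable $x_e$ for each edge $e$ of $K_n$. Let $$\tilde H_{K_n}=\left(\frac{\partial^2 F_{K_n}}{\partial x_i\,\partial x_j}\Big|_{x_e=1\text{ for all }e}\right)_{i,j\in E(K_n)},$$ a real $\binom n2\times\binom n2$ matrix. Then the eigenspaces of $\tilde H_{K_n}$ for $$-2n^{n-4},\qquad -n^{n-3},\qquad 2(n-2)n^{n-3}$$ have dimensions $\binom n2-n$, $n-1$ and $1$, respectively, and $\tilde H_{K_n}$ has no other eigenvalues. (For $n\ge 4$ all three numbers are eigenvalues; for $n=3$ the first dimension is $0$, so that only $-n^{n-3}=-1$ and $2(n-2)n^{n-3}=2$ are eigenvalues.) Consequently the symmetric matrix $\tilde H_{K_n}$ has Lorentzian signature: of its $\binom n2$ eigenvalues, counted with multiplicity, exactly one is positive and all the others are negative. -/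

import Mathlib

namespace SimpleGraph

noncomputable section

variable {V : Type*} [Fintype V]

/-- The finite set of spanning trees of `G`. A spanning tree has the same vertex set `V` as `G`, so
it is a simple graph on `V` that is a tree and all of whose edges are edges of `G`. -/
def spanningTrees (G : SimpleGraph V) : Finset (SimpleGraph V) :=
  (Set.toFinite {T : SimpleGraph V | T ≤ G ∧ T.IsTree}).toFinset

open Classical in
/-- The Kirchhoff polynomial `∑_T ∏_{e ∈ E(T)} x_e`, with `T` running over the spanning trees of
`G`, in one variable `x_e` for each edge `e` of `G`. -/
def kirchhoffPolynomial (R : Type*) [CommRing R] (G : SimpleGraph V) : MvPolynomial G.edgeSet R :=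
  ∑ T ∈ G.spanningTrees, ∏ e : G.edgeSet with e.1 ∈ T.edgeSet, MvPolynomial.X e

/-- The Hessian matrix of `G`: the matrix of second partial derivatives of its Kirchhoff
polynomial, with rows and columns indexed by the edges of `G`. -/
def hessianMatrix (R : Type*) [CommRing R] (G : SimpleGraph V) :
    Matrix G.edgeSet G.edgeSet (MvPolynomial G.edgeSet R) :=
  Matrix.of fun i j =>
    MvPolynomial.pderiv i (MvPolynomial.pderiv j (G.kirchhoffPolynomial R))

/-- The Hessian matrix of `G` with all the variables evaluated at `1`. -/
def hessianMatrixAtOne (R : Type*) [CommRing R] (G : SimpleGraph V) :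
    Matrix G.edgeSet G.edgeSet R :=
  (G.hessianMatrix R).map (MvPolynomial.eval fun _ => 1)

end

end SimpleGraph

/-!
Adding an edge between two components `C` and `D` of a forest with `c` components merges them, and a
tree containing the forest contains exactly `c - 1` such edges. Counting the pairs (tree, added
edge) in two ways shows by induction that a forest on `n` vertices with components `C₁, …, C_c` lies
in `n ^ (c - 2) * ∏ |C_k|` trees. For a pair of edges `i ≠ j` this number is
`n ^ (n - 4) * (4 - |i ∩ j|)`.

Hence, with the incidence matrix `N` of `K_n` and the all-ones matrix `J`, the Hessian is
`n ^ (n - 4) • (Nᵀ * (J - 1) * N - 2)`. Since `A * B` and `B * A` have the same characteristic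
polynomial up to a power of `X`, and `N * Nᵀ = (n - 2) + J`, everything reduces to an `n × n` matrix
in the span of `1` and `J`. The Hessian being symmetric, its eigenspaces have the dimensions given
by the multiplicities of the roots.
-/

namespace CompleteGraphHessian

open SimpleGraph Finset Matrix

section Forests

variable {V : Type*} {F : SimpleGraph V} {u v : V}

theorem reachable_sup_edge_iff (x y : V) :
    (F ⊔ edge u v).Reachable x y ↔ F.Reachable x y ∨
      ((F.Reachable x u ∨ F.Reachable x v) ∧ (F.Reachable y u ∨ F.Reachable y v)) := by
  constructor
  · rintro ⟨w⟩
    induction w with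
    | nil => exact .inl .rfl
    | cons hadj _ ih =>
      rw [sup_adj, edge_adj] at hadj
      rcases hadj with hF | ⟨⟨rfl, rfl⟩ | ⟨rfl, rfl⟩, -⟩
      · exact ih.imp hF.reachable.trans
          (And.imp_left (Or.imp hF.reachable.trans hF.reachable.trans))
      · exact .inr ⟨.inl .rfl, ih.elim (fun h => .inr h.symm) And.right⟩
      · exact .inr ⟨.inr .rfl, ih.elim (fun h => .inl h.symm) And.right⟩
  · have lift {a b : V} (h : F.Reachable a b) : (F ⊔ edge u v).Reachable a b :=
      h.mono le_sup_left
    have reachable_uv : (F ⊔ edge u v).Reachable u v := by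
      by_cases huv : u = v
      · rw [huv]
      · exact Adj.reachable (by simp [edge_adj, huv])
    have reachable_u {a : V} (h : F.Reachable a u ∨ F.Reachable a v) :
        (F ⊔ edge u v).Reachable a u :=
      h.elim lift fun h => (lift h).trans reachable_uv.symm
    rintro (h | ⟨hx, hy⟩)
    · exact lift h
    · exact (reachable_u hx).trans (reachable_u hy).symm

theorem supp_connectedComponentMk_sup_edge :
    ((F ⊔ edge u v).connectedComponentMk u).supp =
      (F.connectedComponentMk u).supp ∪ (F.connectedComponentMk v).supp := by
  ext x
  simp only [ConnectedComponent.mem_supp_iff, ConnectedComponent.eq, reachable_sup_edge_iff,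
    Set.mem_union, Reachable.refl, true_or, and_true, or_self_left]

theorem map_sup_edge_eq_iff (C D : F.ConnectedComponent) :
    C.map (Hom.ofLE (le_sup_left : F ≤ F ⊔ edge u v)) = D.map (Hom.ofLE le_sup_left) ↔
      C = D ∨ ((C = F.connectedComponentMk u ∨ C = F.connectedComponentMk v) ∧
        (D = F.connectedComponentMk u ∨ D = F.connectedComponentMk v)) := by
  induction C, D using ConnectedComponent.ind₂ with | _ x y
  simp only [ConnectedComponent.map_mk, Hom.ofLE_apply, ConnectedComponent.eq,
    reachable_sup_edge_iff]

theorem supp_map_sup_edge {C : F.ConnectedComponent} (hu : C ≠ F.connectedComponentMk u)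
    (hv : C ≠ F.connectedComponentMk v) :
    (C.map (Hom.ofLE (le_sup_left : F ≤ F ⊔ edge u v))).supp = C.supp := by
  ext x
  have h := map_sup_edge_eq_iff (u := u) (v := v) (F.connectedComponentMk x) C
  simp only [hu, hv, or_self, and_false, or_false, ConnectedComponent.map_mk] at h
  exact h

theorem map_sup_edge_injOn :
    Set.InjOn (fun C : F.ConnectedComponent =>
        C.map (Hom.ofLE (le_sup_left : F ≤ F ⊔ edge u v)))
      {F.connectedComponentMk u, F.connectedComponentMk v}ᶜ := by
  intro C hC D _ h
  exact ((map_sup_edge_eq_iff C D).1 h).resolve_right fun h => hC h.1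

theorem compl_connectedComponentMk_sup_edge :
    {(F ⊔ edge u v).connectedComponentMk u}ᶜ =
      (fun C : F.ConnectedComponent => C.map (Hom.ofLE (le_sup_left : F ≤ F ⊔ edge u v))) ''
        {F.connectedComponentMk u, F.connectedComponentMk v}ᶜ := by
  have map_eq_mk_iff (C : F.ConnectedComponent) :
      C.map (Hom.ofLE le_sup_left) = (F ⊔ edge u v).connectedComponentMk u ↔
        C = F.connectedComponentMk u ∨ C = F.connectedComponentMk v := by
    refine (map_sup_edge_eq_iff C (F.connectedComponentMk u)).trans ?_
    simp only [true_or, and_true, or_self_left]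
  ext C'
  constructor
  · obtain ⟨C, rfl⟩ := ConnectedComponent.surjective_map_ofLE le_sup_left C'
    exact fun hC => ⟨C, fun h => hC ((map_eq_mk_iff C).2 h), rfl⟩
  · rintro ⟨C, hC, rfl⟩ h
    exact hC ((map_eq_mk_iff C).1 h)

/-- The number of vertices of the connected component of `x`. -/
noncomputable def componentCard (F : SimpleGraph V) (x : V) : ℕ :=
  (F.connectedComponentMk x).supp.ncard

/-- The product of the numbers of vertices of the connected components of `F`; as a `finprod`, it is
only meaningful if there are finitely many components. -/
noncomputable def componentCardProd (F : SimpleGraph V) : ℕ :=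
  ∏ᶠ C : F.ConnectedComponent, C.supp.ncard

theorem componentCard_sup_edge_of_reachable [Finite V] {x : V} (huv : ¬F.Reachable u v)
    (hx : F.Reachable x u ∨ F.Reachable x v) :
    componentCard (F ⊔ edge u v) x = componentCard F u + componentCard F v := by
  have mk_eq : (F ⊔ edge u v).connectedComponentMk x = (F ⊔ edge u v).connectedComponentMk u :=
    ConnectedComponent.sound ((reachable_sup_edge_iff x u).2 (.inr ⟨hx, .inl .rfl⟩))
  rw [componentCard, mk_eq, supp_connectedComponentMk_sup_edge, Set.ncard_union_eq]
  · rfl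
  · exact pairwise_disjoint_supp_connectedComponent F
      (mt ConnectedComponent.exact huv)

theorem componentCard_sup_edge_of_not_reachable {x : V} (hu : ¬F.Reachable x u)
    (hv : ¬F.Reachable x v) : componentCard (F ⊔ edge u v) x = componentCard F x :=
  congrArg Set.ncard
    (supp_map_sup_edge (mt ConnectedComponent.exact hu) (mt ConnectedComponent.exact hv))

theorem componentCard_pos [Finite V] (F : SimpleGraph V) (x : V) : 0 < componentCard F x :=
  (Set.ncard_pos).2 (F.connectedComponentMk x).nonempty_supp

theorem card_connectedComponent_sup_edge [Finite V] (huv : ¬F.Reachable u v) :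
    Nat.card (F ⊔ edge u v).ConnectedComponent + 1 = Nat.card F.ConnectedComponent := by
  have hF := Set.ncard_add_ncard_compl {F.connectedComponentMk u, F.connectedComponentMk v}
  have hsup := Set.ncard_add_ncard_compl {(F ⊔ edge u v).connectedComponentMk u}
  rw [Set.ncard_pair (mt ConnectedComponent.exact huv)] at hF
  rw [compl_connectedComponentMk_sup_edge, map_sup_edge_injOn.ncard_image,
    Set.ncard_singleton] at hsup
  lia

theorem one_lt_card_connectedComponent [Finite V] (hF : ¬F.Preconnected) :
    1 < Nat.card F.ConnectedComponent := by
  simp only [Preconnected, not_forall] at hF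
  obtain ⟨u, v, huv⟩ := hF
  exact Finite.one_lt_card_iff_nontrivial.2 ⟨_, _, mt ConnectedComponent.exact huv⟩

theorem finprod_mem_mul_finprod_mem_compl {α M : Type*} [Finite α] [CommMonoid M] (s : Set α)
    (f : α → M) : (∏ᶠ i ∈ s, f i) * ∏ᶠ i ∈ sᶜ, f i = ∏ᶠ i, f i := by
  rw [Set.compl_eq_univ_sdiff, finprod_mem_mul_sdiff s.subset_univ Set.finite_univ,
    finprod_mem_univ]

theorem componentCardProd_sup_edge [Finite V] (huv : ¬F.Reachable u v) :
    componentCardProd (F ⊔ edge u v) * (componentCard F u * componentCard F v) =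
      componentCardProd F * (componentCard F u + componentCard F v) := by
  have hF := finprod_mem_mul_finprod_mem_compl
    {F.connectedComponentMk u, F.connectedComponentMk v} fun C => C.supp.ncard
  have hsup := finprod_mem_mul_finprod_mem_compl
    {(F ⊔ edge u v).connectedComponentMk u} fun C => C.supp.ncard
  have hcompl : ∏ᶠ C ∈ ({(F ⊔ edge u v).connectedComponentMk u}ᶜ : Set _), C.supp.ncard =
      ∏ᶠ C ∈ ({F.connectedComponentMk u, F.connectedComponentMk v}ᶜ : Set _), C.supp.ncard := by
    rw [compl_connectedComponentMk_sup_edge, finprod_mem_image map_sup_edge_injOn]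
    refine finprod_mem_congr rfl fun C hC => ?_
    rw [supp_map_sup_edge (fun h => hC (.inl h)) (fun h => hC (.inr h))]
  rw [finprod_mem_pair (mt ConnectedComponent.exact huv)] at hF
  rw [hcompl, finprod_mem_singleton, ← componentCard,
    componentCard_sup_edge_of_reachable huv (.inl .rfl)] at hsup
  rw [componentCardProd, componentCardProd, ← hF, ← hsup, componentCard, componentCard]
  ring

theorem cast_componentCardProd_sup_edge [Finite V] (huv : ¬F.Reachable u v) :
    (componentCardProd (F ⊔ edge u v) : ℚ) =
      componentCardProd F * ((componentCard F u : ℚ)⁻¹ + (componentCard F v : ℚ)⁻¹) := by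
  have hu : (componentCard F u : ℚ) ≠ 0 := by exact_mod_cast (componentCard_pos F u).ne'
  have hv : (componentCard F v : ℚ) ≠ 0 := by exact_mod_cast (componentCard_pos F v).ne'
  have h := congrArg (Nat.cast (R := ℚ)) (componentCardProd_sup_edge huv)
  push_cast at h
  field_simp
  linear_combination h

@[elab_as_elim]
theorem forest_induction [Finite V] {P : SimpleGraph V → Prop}
    (preconnected : ∀ F : SimpleGraph V, F.IsAcyclic → F.Preconnected → P F)
    (sup_edge : ∀ F : SimpleGraph V, F.IsAcyclic → ¬F.Preconnected →
      (∀ u v, ¬F.Reachable u v → P (F ⊔ edge u v)) → P F)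
    (hF : F.IsAcyclic) : P F := by
  induction F using WellFoundedGT.induction with | _ F ih
  by_cases hconn : F.Preconnected
  · exact preconnected F hF hconn
  · refine sup_edge F hF hconn fun u v huv => ih _ ?_ (hF.sup_edge_of_not_reachable huv)
    exact F.lt_sup_edge _ _
      (ne_of_apply_ne F.connectedComponentMk (mt ConnectedComponent.exact huv))
      (mt Adj.reachable huv)

theorem card_edgeSet_add_card_connectedComponent [Finite V] (hF : F.IsAcyclic) :
    Nat.card F.edgeSet + Nat.card F.ConnectedComponent = Nat.card V := by
  refine forest_induction (fun F hF hconn => ?_) (fun F _ hconn ih => ?_) hF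
  · have := hconn.subsingleton_connectedComponent
    cases isEmpty_or_nonempty V
    · have : IsEmpty F.ConnectedComponent := by
        unfold ConnectedComponent; infer_instance
      simp
    · rw [← (isTree_iff_connected_and_card.1 ⟨⟨hconn⟩, hF⟩).2,
        Nat.card_unique (α := F.ConnectedComponent)]
  · classical
    have := Fintype.ofFinite V
    simp only [Preconnected, not_forall] at hconn
    obtain ⟨u, v, huv⟩ := hconn
    have hedges : Nat.card (F ⊔ edge u v).edgeSet = Nat.card F.edgeSet + 1 := by
      simp only [Nat.card_eq_fintype_card, ← edgeFinset_card]
      exact F.card_edgeFinset_sup_edge (mt Adj.reachable huv)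
        (ne_of_apply_ne F.connectedComponentMk (mt ConnectedComponent.exact huv))
    have := ih u v huv
    have := card_connectedComponent_sup_edge huv
    lia

theorem sdiff_adj_iff_of_isAcyclic {T : SimpleGraph V} (hT : T.IsAcyclic) (hFT : F ≤ T) :
    (T \ F).Adj u v ↔ T.Adj u v ∧ ¬F.Reachable u v := by
  rw [sdiff_adj]
  refine and_congr_right fun hadj => not_congr ⟨Adj.reachable, fun hreach => ?_⟩
  have hle : F ⊔ edge u v ≤ T := sup_le hFT ((edge_le_iff T).2 (.inr hadj))
  exact ((isAcyclic_sup_fromEdgeSet_iff.1 (hT.anti hle)).2 hreach).resolve_left hadj.ne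

theorem card_adj_pairs [Fintype V] (G : SimpleGraph V) [DecidableRel G.Adj] :
    #{p : V × V | G.Adj p.1 p.2} = 2 * Nat.card G.edgeSet := by
  rw [Nat.card_eq_fintype_card, ← edgeFinset_card, ← sum_degrees_eq_twice_card_edges, card_filter,
    Fintype.sum_prod_type]
  refine sum_congr rfl fun u _ => ?_
  rw [← card_filter, ← neighborFinset_eq_filter, card_neighborFinset_eq_degree]

open Classical in
theorem card_tree_adj_not_reachable [Fintype V] {T : SimpleGraph V} (hT : T.IsTree) (hFT : F ≤ T) :
    #{p : V × V | T.Adj p.1 p.2 ∧ ¬F.Reachable p.1 p.2} + 2 =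
      2 * Nat.card F.ConnectedComponent := by
  simp only [← sdiff_adj_iff_of_isAcyclic hT.isAcyclic hFT, card_adj_pairs, edgeSet_sdiff]
  have hF := card_edgeSet_add_card_connectedComponent (hT.isAcyclic.anti hFT)
  have hT := (isTree_iff_connected_and_card.1 hT).2
  have hsdiff := Set.ncard_sdiff_add_ncard_of_subset (edgeSet_mono hFT)
  simp only [Nat.card_coe_set_eq] at hF hT ⊢
  lia

variable [Fintype V]

theorem sum_inv_componentCard (F : SimpleGraph V) :
    ∑ x, (componentCard F x : ℚ)⁻¹ = Nat.card F.ConnectedComponent := by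
  classical
  have card_fiber (C : F.ConnectedComponent) :
      #{x | F.connectedComponentMk x = C} = C.supp.ncard := by
    rw [← Set.ncard_coe_finset, coe_filter_univ]
    rfl
  have supp_ncard_ne_zero (C : F.ConnectedComponent) : (C.supp.ncard : ℚ) ≠ 0 := by
    exact_mod_cast (Set.ncard_pos).2 C.nonempty_supp |>.ne'
  rw [← sum_fiberwise univ F.connectedComponentMk]
  calc ∑ C, ∑ x with F.connectedComponentMk x = C, (componentCard F x : ℚ)⁻¹
      = ∑ C, ∑ x with F.connectedComponentMk x = C, (C.supp.ncard : ℚ)⁻¹ :=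
        sum_congr rfl fun _ _ => sum_congr rfl fun x hx => by
          rw [componentCard, (mem_filter.1 hx).2]
    _ = ∑ _ : F.ConnectedComponent, (1 : ℚ) := by
        simp only [sum_const, card_fiber, nsmul_eq_mul, mul_inv_cancel₀ (supp_ncard_ne_zero _)]
    _ = Nat.card F.ConnectedComponent := by simp

open Classical in
theorem card_not_reachable (F : SimpleGraph V) (x : V) :
    (#{y | ¬F.Reachable x y} : ℚ) = Fintype.card V - componentCard F x := by
  have hcard : #{y | F.Reachable x y} = componentCard F x := by
    rw [← Set.ncard_coe_finset, coe_filter_univ]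
    refine congrArg Set.ncard (Set.ext fun y => ?_)
    exact reachable_comm.trans ConnectedComponent.eq.symm
  rw [← card_univ, ← hcard, ← card_filter_add_card_filter_not (s := univ) (F.Reachable x)]
  push_cast
  ring

open Classical in
theorem sum_not_reachable_inv_componentCard (F : SimpleGraph V) :
    ∑ p : V × V with ¬F.Reachable p.1 p.2,
        ((componentCard F p.1 : ℚ)⁻¹ + (componentCard F p.2 : ℚ)⁻¹) =
      2 * Fintype.card V * (Nat.card F.ConnectedComponent - 1) := by
  have sum_left : ∑ p : V × V with ¬F.Reachable p.1 p.2, (componentCard F p.1 : ℚ)⁻¹ =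
      Fintype.card V * (Nat.card F.ConnectedComponent - 1) := by
    have sum_fiber (x : V) : ∑ y with ¬F.Reachable x y, (componentCard F x : ℚ)⁻¹ =
        Fintype.card V * (componentCard F x : ℚ)⁻¹ - 1 := by
      have hpos : (componentCard F x : ℚ) ≠ 0 := by exact_mod_cast (componentCard_pos F x).ne'
      rw [sum_const, nsmul_eq_mul, card_not_reachable, sub_mul, mul_inv_cancel₀ hpos]
    rw [sum_filter, Fintype.sum_prod_type]
    simp only [← sum_filter, sum_fiber, sum_sub_distrib, ← mul_sum, sum_inv_componentCard,
      sum_const, card_univ, nsmul_eq_mul]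
    ring
  have sum_right : ∑ p : V × V with ¬F.Reachable p.1 p.2, (componentCard F p.2 : ℚ)⁻¹ =
      Fintype.card V * (Nat.card F.ConnectedComponent - 1) := by
    rw [← sum_left]
    exact sum_equiv (Equiv.prodComm V V) (by simp [reachable_comm]) (by simp)
  rw [sum_add_distrib, sum_left, sum_right]
  ring

open Classical in
/-- The trees on the vertex set `V` that contain all the edges of `F`. -/
noncomputable def treesContaining (F : SimpleGraph V) : Finset (SimpleGraph V) :=
  {T | T.IsTree ∧ F ≤ T}

theorem mem_treesContaining {T : SimpleGraph V} : T ∈ treesContaining F ↔ T.IsTree ∧ F ≤ T := by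
  simp [treesContaining]

theorem treesContaining_eq_singleton (hF : F.IsTree) : treesContaining F = {F} := by
  ext T
  rw [mem_treesContaining, mem_singleton]
  refine ⟨fun hT => ?_, fun hT => hT.symm ▸ ⟨hF, le_rfl⟩⟩
  exact ((isTree_iff_minimal_connected.1 hT.1).eq_of_le hF.connected hT.2).symm

open Classical in
theorem sum_card_treesContaining_sup_edge (F : SimpleGraph V) :
    ∑ p : V × V with ¬F.Reachable p.1 p.2, (#(treesContaining (F ⊔ edge p.1 p.2)) : ℚ) =
      #(treesContaining F) * (2 * (Nat.card F.ConnectedComponent - 1)) := by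
  have treesContaining_sup_edge (p : V × V) (hp : ¬F.Reachable p.1 p.2) :
      treesContaining (F ⊔ edge p.1 p.2) = {T ∈ treesContaining F | T.Adj p.1 p.2} := by
    have hne : p.1 ≠ p.2 := fun h => hp (h ▸ .rfl)
    ext T
    simp only [mem_treesContaining, mem_filter, sup_le_iff, edge_le_iff, hne, false_or, and_assoc]
  have card_pairs (T) (hT : T ∈ treesContaining F) :
      (#{p ∈ ({p | ¬F.Reachable p.1 p.2} : Finset (V × V)) | T.Adj p.1 p.2} : ℚ) =
        2 * (Nat.card F.ConnectedComponent - 1) := by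
    obtain ⟨hT, hFT⟩ := mem_treesContaining.1 hT
    have h := congrArg (Nat.cast : ℕ → ℚ) (card_tree_adj_not_reachable hT hFT)
    push_cast at h
    simp only [filter_filter, and_comm] at h ⊢
    linear_combination h
  calc ∑ p : V × V with ¬F.Reachable p.1 p.2, (#(treesContaining (F ⊔ edge p.1 p.2)) : ℚ)
      = ∑ p : V × V with ¬F.Reachable p.1 p.2, (#{T ∈ treesContaining F | T.Adj p.1 p.2} : ℚ) :=
        sum_congr rfl fun p hp => by rw [treesContaining_sup_edge p (mem_filter.1 hp).2]
    _ = ∑ T ∈ treesContaining F,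
          (#{p ∈ ({p | ¬F.Reachable p.1 p.2} : Finset (V × V)) | T.Adj p.1 p.2} : ℚ) := by
        exact_mod_cast sum_card_bipartiteAbove_eq_sum_card_bipartiteBelow
          fun (p : V × V) (T : SimpleGraph V) => T.Adj p.1 p.2
    _ = #(treesContaining F) * (2 * (Nat.card F.ConnectedComponent - 1)) := by
        rw [sum_congr rfl card_pairs, sum_const, nsmul_eq_mul]

theorem card_treesContaining_mul_sq [Nonempty V] (hF : F.IsAcyclic) :
    #(treesContaining F) * Fintype.card V ^ 2 =
      Fintype.card V ^ Nat.card F.ConnectedComponent * componentCardProd F := by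
  classical
  refine forest_induction (fun F hF hconn => ?_) (fun F _ hconn ih => ?_) hF
  · have := hconn.subsingleton_connectedComponent
    have C : F.ConnectedComponent := F.connectedComponentMk (Classical.arbitrary V)
    have : Unique F.ConnectedComponent := uniqueOfSubsingleton C
    have hsupp : (default : F.ConnectedComponent).supp = Set.univ :=
      Set.eq_univ_of_forall fun x => Subsingleton.elim _ _
    rw [treesContaining_eq_singleton ⟨⟨hconn⟩, hF⟩, componentCardProd, finprod_unique, hsupp]
    simp [sq]
  · have card_sup_edge (p : V × V) (hp : ¬F.Reachable p.1 p.2) :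
        (#(treesContaining (F ⊔ edge p.1 p.2)) : ℚ) * Fintype.card V ^ 3 =
          Fintype.card V ^ Nat.card F.ConnectedComponent * componentCardProd F *
            ((componentCard F p.1 : ℚ)⁻¹ + (componentCard F p.2 : ℚ)⁻¹) := by
      have h := congrArg (Nat.cast (R := ℚ)) (ih p.1 p.2 hp)
      push_cast at h
      rw [mul_assoc, ← cast_componentCardProd_sup_edge hp, ← card_connectedComponent_sup_edge hp]
      linear_combination (Fintype.card V : ℚ) * h
    have hsum := sum_congr (s₁ := {p : V × V | ¬F.Reachable p.1 p.2}) rfl fun p hp =>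
      card_sup_edge p (mem_filter.1 hp).2
    rw [← sum_mul, ← mul_sum, sum_card_treesContaining_sup_edge,
      sum_not_reachable_inv_componentCard] at hsum
    have hc : (Nat.card F.ConnectedComponent : ℚ) - 1 ≠ 0 :=
      sub_ne_zero.2 (by exact_mod_cast (one_lt_card_connectedComponent hconn).ne')
    have hV : (Fintype.card V : ℚ) ≠ 0 := by simp
    rw [← Nat.cast_inj (R := ℚ)]
    push_cast
    apply mul_left_cancel₀ (mul_ne_zero (mul_ne_zero two_ne_zero hc) hV)
    linear_combination hsum

end Forests

section TwoEdges

variable {V : Type*}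

theorem componentCard_bot (x : V) : componentCard (⊥ : SimpleGraph V) x = 1 := by
  rw [componentCard, Set.ncard_eq_one]
  refine ⟨x, Set.ext fun y => ?_⟩
  simp only [ConnectedComponent.mem_supp_iff, ConnectedComponent.eq, reachable_bot,
    Set.mem_singleton_iff]

theorem componentCardProd_bot : componentCardProd (⊥ : SimpleGraph V) = 1 := by
  refine finprod_eq_one_of_forall_eq_one fun C => ?_
  induction C using ConnectedComponent.ind with | _ x
  exact componentCard_bot x

variable {a b c d : V}

theorem not_reachable_edge (hcd : c ≠ d) (hne : s(a, b) ≠ s(c, d)) :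
    ¬(edge a b).Reachable c d := by
  rw [← bot_sup_eq (edge a b), reachable_sup_edge_iff]
  simp only [reachable_bot, ne_eq, Sym2.eq_iff] at hne ⊢
  grind

theorem isAcyclic_edge_sup_edge (hab : a ≠ b) (hcd : c ≠ d) (hne : s(a, b) ≠ s(c, d)) :
    (edge a b ⊔ edge c d).IsAcyclic := by
  refine IsAcyclic.sup_edge_of_not_reachable (not_reachable_edge hcd hne) ?_
  rw [← bot_sup_eq (edge a b)]
  exact isAcyclic_bot.sup_edge_of_not_reachable (by simpa using hab)

variable [Finite V]

theorem componentCard_edge [DecidableEq V] (hab : a ≠ b) (x : V) :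
    componentCard (edge a b) x = if x = a ∨ x = b then 2 else 1 := by
  rw [← bot_sup_eq (edge a b)]
  split_ifs with hx
  · rw [componentCard_sup_edge_of_reachable (by simpa using hab) (by simpa using hx),
      componentCard_bot, componentCard_bot]
  · simp only [not_or] at hx
    rw [componentCard_sup_edge_of_not_reachable (by simpa using hx.1) (by simpa using hx.2),
      componentCard_bot]

theorem componentCardProd_edge (hab : a ≠ b) : componentCardProd (edge a b) = 2 := by
  have h := componentCardProd_sup_edge (F := ⊥) (u := a) (v := b) (by simpa using hab)
  simpa [componentCardProd_bot, componentCard_bot] using h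

theorem card_connectedComponent_edge_sup_edge (hab : a ≠ b) (hcd : c ≠ d)
    (hne : s(a, b) ≠ s(c, d)) :
    Nat.card (edge a b ⊔ edge c d).ConnectedComponent + 2 = Nat.card V := by
  have hbot := card_edgeSet_add_card_connectedComponent (V := V) isAcyclic_bot
  have h₁ := card_connectedComponent_sup_edge (F := ⊥) (u := a) (v := b) (by simpa using hab)
  have h₂ := card_connectedComponent_sup_edge (not_reachable_edge hcd hne)
  rw [bot_sup_eq] at h₁
  simp only [edgeSet_bot, Nat.card_eq_fintype_card, Fintype.card_eq_zero] at hbot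
  lia

theorem componentCardProd_edge_sup_edge [Fintype V] [DecidableEq V] (hab : a ≠ b) (hcd : c ≠ d)
    (hne : s(a, b) ≠ s(c, d)) :
    componentCardProd (edge a b ⊔ edge c d) + #{x | x ∈ s(a, b) ∧ x ∈ s(c, d)} = 4 := by
  have hprod := componentCardProd_sup_edge (not_reachable_edge hcd hne)
  have hinter : #{x | x ∈ s(a, b) ∧ x ∈ s(c, d)} =
      (if c = a ∨ c = b then 1 else 0) + (if d = a ∨ d = b then 1 else 0) := by
    rw [← sum_pair (f := fun x => if x = a ∨ x = b then 1 else 0) hcd, ← card_filter]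
    congr 1
    ext x
    simp [and_comm]
  have hnot : ¬((c = a ∨ c = b) ∧ (d = a ∨ d = b)) := by
    simp only [ne_eq, Sym2.eq_iff] at hne
    grind
  rw [componentCardProd_edge hab, componentCard_edge hab, componentCard_edge hab] at hprod
  rw [hinter]
  split_ifs at hprod ⊢ <;> lia

end TwoEdges

section Hessian

theorem pderiv_prod_X_of_notMem {σ R : Type*} [CommSemiring R] {i : σ} {s : Finset σ}
    (hi : i ∉ s) : MvPolynomial.pderiv i (∏ e ∈ s, (MvPolynomial.X e : MvPolynomial σ R)) = 0 := by
  refine prod_induction _ (fun p => MvPolynomial.pderiv i p = 0) (fun p q hp hq => ?_)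
    (Derivation.map_one_eq_zero _) fun e he => ?_
  · rw [Derivation.leibniz, hp, hq, smul_zero, smul_zero, add_zero]
  · exact MvPolynomial.pderiv_X_of_ne (ne_of_mem_of_not_mem he hi)

theorem pderiv_prod_X_of_mem {σ R : Type*} [CommSemiring R] [DecidableEq σ] {i : σ} {s : Finset σ}
    (hi : i ∈ s) : MvPolynomial.pderiv i (∏ e ∈ s, (MvPolynomial.X e : MvPolynomial σ R)) =
      ∏ e ∈ s.erase i, MvPolynomial.X e := by
  rw [← mul_prod_erase s _ hi, Derivation.leibniz, pderiv_prod_X_of_notMem (notMem_erase i s),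
    MvPolynomial.pderiv_X_self, smul_zero, zero_add, smul_eq_mul, mul_one]

theorem eval_one_pderiv_pderiv_prod_X {σ R : Type*} [CommSemiring R] [DecidableEq σ] (i j : σ)
    (s : Finset σ) :
    MvPolynomial.eval (fun _ => (1 : R)) (MvPolynomial.pderiv i (MvPolynomial.pderiv j
      (∏ e ∈ s, MvPolynomial.X e))) = if i ≠ j ∧ i ∈ s ∧ j ∈ s then 1 else 0 := by
  by_cases hj : j ∈ s
  · rw [pderiv_prod_X_of_mem hj]
    by_cases hi : i ∈ s.erase j
    · have h := mem_erase.1 hi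
      simp [pderiv_prod_X_of_mem hi, map_prod, h, hj]
    · rw [pderiv_prod_X_of_notMem hi, map_zero, if_neg]
      exact fun h => hi (mem_erase.2 ⟨h.1, h.2.1⟩)
  · simp [pderiv_prod_X_of_notMem hj, hj]

variable {V : Type*} [Fintype V]

open Classical in
theorem hessianMatrixAtOne_apply (R : Type*) [CommRing R] (G : SimpleGraph V) (i j : G.edgeSet) :
    G.hessianMatrixAtOne R i j = if i = j then 0 else
      (#{T ∈ G.spanningTrees | i.1 ∈ T.edgeSet ∧ j.1 ∈ T.edgeSet} : R) := by
  simp only [hessianMatrixAtOne, hessianMatrix, Matrix.map_apply, Matrix.of_apply,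
    kirchhoffPolynomial, map_sum, eval_one_pderiv_pderiv_prod_X, mem_filter, mem_univ, true_and]
  split_ifs with hij
  · simp [hij]
  · simp [hij]

theorem isSymm_hessianMatrixAtOne (R : Type*) [CommRing R] (G : SimpleGraph V) :
    (G.hessianMatrixAtOne R).IsSymm := by
  ext i j
  rw [transpose_apply, hessianMatrixAtOne_apply, hessianMatrixAtOne_apply]
  classical
  refine if_congr eq_comm rfl ?_
  simp only [and_comm]

open Classical in
theorem filter_spanningTrees_top {a b c d : V} (hab : a ≠ b) (hcd : c ≠ d) :
    {T ∈ (⊤ : SimpleGraph V).spanningTrees | s(a, b) ∈ T.edgeSet ∧ s(c, d) ∈ T.edgeSet} =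
      treesContaining (edge a b ⊔ edge c d) := by
  ext T
  simp [mem_treesContaining, spanningTrees, hab, hcd]

theorem hessianMatrixAtOne_top_mul_sq (R : Type*) [CommRing R] [DecidableEq V]
    {i j : (⊤ : SimpleGraph V).edgeSet} (hij : i ≠ j) :
    (⊤ : SimpleGraph V).hessianMatrixAtOne R i j * Fintype.card V ^ 2 =
      Fintype.card V ^ (Fintype.card V - 2) * (4 - (#{x | x ∈ i.1 ∧ x ∈ j.1} : R)) := by
  rw [hessianMatrixAtOne_apply, if_neg hij]
  obtain ⟨i, hi⟩ := i
  obtain ⟨j, hj⟩ := j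
  induction i with | _ a b
  induction j with | _ c d
  have hne : s(a, b) ≠ s(c, d) := fun h => hij (Subtype.ext h)
  rw [mem_edgeSet, top_adj] at hi hj
  have : Nonempty V := ⟨a⟩
  have hcount := card_treesContaining_mul_sq (isAcyclic_edge_sup_edge hi hj hne)
  have hcard := card_connectedComponent_edge_sup_edge hi hj hne
  have hprod := congrArg (Nat.cast (R := R)) (componentCardProd_edge_sup_edge hi hj hne)
  rw [Nat.card_eq_fintype_card (α := V)] at hcard
  push_cast at hprod
  rw [filter_spanningTrees_top hi hj, ← hcard, Nat.add_sub_cancel, hcard, ← hprod,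
    add_sub_cancel_right]
  simpa only [Nat.cast_mul, Nat.cast_pow] using congrArg (Nat.cast (R := R)) hcount

end Hessian

section Incidence

variable {V : Type*} [DecidableEq V]

/-- The incidence matrix of `G` with one column for each edge of `G`, whereas the columns of
`SimpleGraph.incMatrix` are indexed by all of `Sym2 V`. -/
def edgeIncMatrix (R : Type*) [Zero R] [One R] (G : SimpleGraph V) [DecidableRel G.Adj] :
    Matrix V G.edgeSet R :=
  (G.incMatrix R).submatrix id Subtype.val

theorem edgeIncMatrix_apply {R : Type*} [MulZeroOneClass R] (G : SimpleGraph V) [DecidableRel G.Adj]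
    (x : V) (e : G.edgeSet) : edgeIncMatrix R G x e = if x ∈ e.1 then 1 else 0 := by
  rw [edgeIncMatrix, submatrix_apply, incMatrix_apply']
  exact if_congr (and_iff_right e.2) rfl rfl

variable [Fintype V] {R : Type*}

theorem one_vecMul_edgeIncMatrix [NonAssocSemiring R] (G : SimpleGraph V) [DecidableRel G.Adj] :
    1 ᵥ* edgeIncMatrix R G = 2 := by
  ext e
  rw [vecMul, one_dotProduct]
  exact G.sum_incMatrix_apply_of_mem_edgeSet e.2

theorem transpose_edgeIncMatrix_mul_self_apply [NonAssocSemiring R] (G : SimpleGraph V)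
    [DecidableRel G.Adj] (i j : G.edgeSet) :
    ((edgeIncMatrix R G)ᵀ * edgeIncMatrix R G) i j = #{x | x ∈ i.1 ∧ x ∈ j.1} := by
  simp only [mul_apply, transpose_apply, edgeIncMatrix_apply, ite_zero_mul_ite_zero, mul_one,
    sum_boole]

theorem card_endpoints {G : SimpleGraph V} {e : Sym2 V} (he : e ∈ G.edgeSet) :
    #{x | x ∈ e} = 2 := by
  induction e with | _ a b
  rw [← card_pair (G.ne_of_adj he)]
  congr 1
  ext x
  simp

theorem edgeIncMatrix_mul_transpose [Semiring R] (G : SimpleGraph V) [DecidableRel G.Adj] :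
    edgeIncMatrix R G * (edgeIncMatrix R G)ᵀ = G.incMatrix R * (G.incMatrix R)ᵀ := by
  ext x y
  simp only [mul_apply, transpose_apply, edgeIncMatrix, submatrix_apply, id]
  rw [Finset.sum_set_coe (f := fun e => G.incMatrix R x e * G.incMatrix R y e)]
  refine sum_subset (subset_univ _) fun e _ he => ?_
  rw [G.incMatrix_of_notMem_incidenceSet fun h => he (Set.mem_toFinset.2 h.1), zero_mul]

theorem edgeIncMatrix_top_mul_transpose [Ring R] :
    edgeIncMatrix R (⊤ : SimpleGraph V) * (edgeIncMatrix R (⊤ : SimpleGraph V))ᵀ =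
      ((Fintype.card V : R) - 2) • 1 + vecMulVec 1 1 := by
  rw [edgeIncMatrix_mul_transpose, incMatrix_mul_transpose]
  ext x y
  have card_pos : 1 ≤ Fintype.card V := Fintype.card_pos_iff.2 ⟨x⟩
  by_cases h : x = y
  · subst h
    norm_num [card_pos, sub_add]
  · simp [h]

end Incidence

section Charpoly

open Polynomial

variable {V R : Type*} [Fintype V] [DecidableEq V] [CommRing R]

theorem smul_vecMulVec_one_sub_one_mul (c : R) :
    c • (vecMulVec 1 1 - 1 : Matrix V V R) *
        (((Fintype.card V : R) - 2) • 1 + vecMulVec 1 1) =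
      vecMulVec (fun _ => c * (2 * Fintype.card V - 3)) 1 -
        scalar V (c * (Fintype.card V - 2)) := by
  rw [smul_mul_assoc, sub_mul, mul_add, vecMulVec_mul_vecMulVec, one_dotProduct_one]
  ext x y
  simp only [scalar_apply, Matrix.smul_apply, Matrix.sub_apply, Matrix.add_apply, mul_one,
    one_mul, vecMulVec_apply, diagonal_apply, Matrix.one_apply, Pi.one_apply, Pi.smul_apply,
    smul_eq_mul, Matrix.mul_smul]
  split_ifs <;> ring

theorem charpoly_vecMulVec_const_one_sub_scalar [Nonempty V] (a b : R) :
    (vecMulVec (fun _ => a) 1 - scalar V b).charpoly =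
      (X + C b) ^ (Fintype.card V - 1) * (X + C (b - Fintype.card V * a)) := by
  have hdot : (fun _ : V => a) ⬝ᵥ 1 = Fintype.card V * a := by simp [dotProduct]
  rw [charpoly_sub_scalar, charpoly_vecMulVec, hdot]
  nth_rw 1 [← Nat.sub_add_cancel (Fintype.card_pos (α := V)), pow_succ]
  simp only [smul_eq_C_mul, sub_comp, mul_comp, pow_comp, X_comp, C_comp, C_sub]
  ring

theorem le_choose_two {n : ℕ} (hn : 3 ≤ n) : n ≤ n.choose 2 := by
  rw [Nat.choose_two_right, Nat.le_div_iff_mul_le two_pos]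
  exact Nat.mul_le_mul_left n (by lia)

theorem lt_choose_two_iff {n : ℕ} : n < n.choose 2 ↔ 4 ≤ n := by
  rw [Nat.choose_two_right, Nat.lt_div_iff_mul_lt two_pos]
  constructor
  · intro h
    by_contra!
    interval_cases n <;> simp at h
  · intro h
    have := Nat.mul_le_mul_left n (show 3 ≤ n - 1 by lia)
    lia

theorem card_edgeSet_top :
    Fintype.card (⊤ : SimpleGraph V).edgeSet = (Fintype.card V).choose 2 := by
  rw [← edgeFinset_card, card_edgeFinset_top_eq_card_choose_two]

theorem charpoly_transpose_edgeIncMatrix_mul (hV : 3 ≤ Fintype.card V) (c : R) :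
    ((edgeIncMatrix R (⊤ : SimpleGraph V))ᵀ * (c • (vecMulVec 1 1 - 1 : Matrix V V R) *
        edgeIncMatrix R (⊤ : SimpleGraph V)) - scalar _ (2 * c)).charpoly =
      (X + C (2 * c)) ^ ((Fintype.card V).choose 2 - Fintype.card V) *
        (X + C (c * Fintype.card V)) ^ (Fintype.card V - 1) *
        (X - C (2 * (Fintype.card V - 2) * (c * Fintype.card V))) := by
  have : Nonempty V := Fintype.card_pos_iff.1 (by lia)
  rw [charpoly_sub_scalar, charpoly_mul_comm_of_le, Matrix.mul_assoc,
    edgeIncMatrix_top_mul_transpose, smul_vecMulVec_one_sub_one_mul,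
    charpoly_vecMulVec_const_one_sub_scalar, card_edgeSet_top]
  · simp only [mul_comp, pow_comp, add_comp, X_comp, C_comp, add_assoc, ← C_add, mul_assoc,
      sub_eq_add_neg (X : R[X]), ← C_neg]
    congr 5 <;> ring
  · rw [card_edgeSet_top]
    exact le_choose_two hV

end Charpoly

section HessianTop

variable {V : Type*} [Fintype V] [DecidableEq V]

theorem transpose_edgeIncMatrix_mul_apply {R : Type*} [CommRing R] (G : SimpleGraph V)
    [DecidableRel G.Adj] (c : R) (i j : G.edgeSet) :
    ((edgeIncMatrix R G)ᵀ * (c • (vecMulVec 1 1 - 1 : Matrix V V R) * edgeIncMatrix R G) :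
      Matrix G.edgeSet G.edgeSet R) i j = c * (4 - #{x | x ∈ i.1 ∧ x ∈ j.1}) := by
  rw [Matrix.smul_mul, Matrix.sub_mul, Matrix.one_mul, vecMulVec_mul, Matrix.mul_smul,
    Matrix.mul_sub, mul_vecMulVec, mulVec_transpose, one_vecMul_edgeIncMatrix, Matrix.smul_apply,
    Matrix.sub_apply, transpose_edgeIncMatrix_mul_self_apply]
  norm_num [vecMulVec_apply]

theorem hessianMatrixAtOne_top_eq {K : Type*} [Field K] [CharZero K] (hV : 3 ≤ Fintype.card V)
    {c : K} (hc : c = (Fintype.card V : K) ^ ((Fintype.card V : ℤ) - 4)) :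
    (⊤ : SimpleGraph V).hessianMatrixAtOne K =
      (edgeIncMatrix K (⊤ : SimpleGraph V))ᵀ * (c • (vecMulVec 1 1 - 1 : Matrix V V K) *
        edgeIncMatrix K (⊤ : SimpleGraph V)) - scalar _ (2 * c) := by
  have hV0 : (Fintype.card V : K) ≠ 0 := Nat.cast_ne_zero.2 (by lia)
  have hc2 : (Fintype.card V : K) ^ (Fintype.card V - 2) = c * Fintype.card V ^ 2 := by
    rw [hc, ← zpow_natCast, ← zpow_natCast, ← zpow_add₀ hV0]
    congr 1
    lia
  ext i j
  rw [Matrix.sub_apply, transpose_edgeIncMatrix_mul_apply, scalar_apply, diagonal_apply]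
  split_ifs with hij
  · subst hij
    rw [hessianMatrixAtOne_apply, if_pos rfl]
    simp only [and_self, card_endpoints i.2]
    norm_num [mul_comm]
  · rw [sub_zero]
    apply mul_right_cancel₀ (pow_ne_zero 2 hV0)
    rw [hessianMatrixAtOne_top_mul_sq K hij, hc2]
    ring

end HessianTop

section Eigenspaces

variable {K m : Type*} [Field K] [LinearOrder K] [IsStrictOrderedRing K] [Fintype m] [DecidableEq m]

open Module.End

theorem maxGenEigenspace_toLin'_of_isSymm {A : Matrix m m K} (hA : A.IsSymm) (μ : K) :
    maxGenEigenspace (toLin' A) μ = eigenspace (toLin' A) μ := by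
  have sub_eq : toLin' A - μ • 1 = toLin' (A - scalar m μ) := by
    rw [map_sub, scalar_apply, ← smul_one_eq_diagonal, map_smul, toLin'_one]
    rfl
  have ker_sq : LinearMap.ker ((toLin' A - μ • 1) ^ 1) =
      LinearMap.ker ((toLin' A - μ • 1) ^ 2) := by
    have hsymm : (A - scalar m μ)ᵀ = A - scalar m μ := by
      rw [transpose_sub, hA.eq, scalar_apply, diagonal_transpose]
    have h := ker_mulVecLin_transpose_mul_self (A - scalar m μ)
    rw [hsymm, ← toLin'_apply', ← toLin'_apply', toLin'_mul] at h
    rw [sub_eq, pow_one, sq]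
    exact h.symm
  refine le_antisymm (fun x hx => ?_) eigenspace_le_maxGenEigenspace
  obtain ⟨k, hk⟩ := (mem_maxGenEigenspace _ _ _).1 hx
  rw [eigenspace_def, ← pow_one (toLin' A - μ • 1), ker_pow_constant ker_sq k, LinearMap.mem_ker,
    pow_add, Module.End.mul_apply, hk, map_zero]

theorem finrank_eigenspace_toLin'_of_isSymm {A : Matrix m m K} (hA : A.IsSymm) (μ : K) :
    Module.finrank K (eigenspace (toLin' A) μ) = A.charpoly.roots.count μ := by
  rw [← maxGenEigenspace_toLin'_of_isSymm hA, LinearMap.finrank_maxGenEigenspace_eq,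
    Polynomial.count_roots, charpoly_toLin']

theorem hasEigenvalue_toLin'_iff_mem_roots_charpoly {R m : Type*} [CommRing R] [IsDomain R]
    [Fintype m] [DecidableEq m] (A : Matrix m m R) (μ : R) :
    HasEigenvalue (toLin' A) μ ↔ μ ∈ A.charpoly.roots := by
  rw [hasEigenvalue_iff_isRoot_charpoly, charpoly_toLin',
    Polynomial.mem_roots A.charpoly_monic.ne_zero]

end Eigenspaces

section Spectrum

open Polynomial in
theorem roots_X_add_C_pow_mul {R : Type*} [CommRing R] [IsDomain R] (a b d : R) (k l : ℕ) :
    ((X + C a) ^ k * (X + C b) ^ l * (X - C d)).roots =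
      Multiset.replicate k (-a) + Multiset.replicate l (-b) + {d} := by
  have hab : (X + C a) ^ k * (X + C b) ^ l ≠ 0 :=
    mul_ne_zero (pow_ne_zero k (X_add_C_ne_zero a)) (pow_ne_zero l (X_add_C_ne_zero b))
  rw [roots_mul (mul_ne_zero hab (X_sub_C_ne_zero d)), roots_mul hab, roots_pow, roots_pow,
    roots_X_add_C, roots_X_add_C, roots_X_sub_C, Multiset.nsmul_singleton,
    Multiset.nsmul_singleton]

theorem filter_replicate {α : Type*} (p : α → Prop) [DecidablePred p] (k : ℕ) (a : α) :
    (Multiset.replicate k a).filter p = if p a then Multiset.replicate k a else 0 := by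
  split_ifs with ha
  · exact Multiset.filter_eq_self.2 fun b hb => Multiset.eq_of_mem_replicate hb ▸ ha
  · exact Multiset.filter_eq_nil.2 fun b hb => Multiset.eq_of_mem_replicate hb ▸ ha

theorem roots_charpoly_hessianMatrixAtOne_top {K V : Type*} [Field K] [CharZero K] [Fintype V]
    [DecidableEq V] {n : ℕ} (hn : 3 ≤ n) (hV : Fintype.card V = n) :
    ((⊤ : SimpleGraph V).hessianMatrixAtOne K).charpoly.roots =
      Multiset.replicate (n.choose 2 - n) (-2 * (n : K) ^ ((n : ℤ) - 4)) +
        Multiset.replicate (n - 1) (-(n : K) ^ ((n : ℤ) - 3)) +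
        {2 * ((n : K) - 2) * (n : K) ^ ((n : ℤ) - 3)} := by
  subst hV
  have zpow_sub_three : (Fintype.card V : K) ^ ((Fintype.card V : ℤ) - 4) * Fintype.card V =
      (Fintype.card V : K) ^ ((Fintype.card V : ℤ) - 3) := by
    rw [← zpow_add_one₀ (Nat.cast_ne_zero.2 (by lia))]
    congr 1
    ring
  rw [hessianMatrixAtOne_top_eq hn rfl, charpoly_transpose_edgeIncMatrix_mul hn, zpow_sub_three,
    roots_X_add_C_pow_mul, neg_mul]

theorem eigenvalues_strictly_ordered {K : Type*} [Field K] [LinearOrder K]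
    [IsStrictOrderedRing K] {n : ℕ} (hn : 3 ≤ n) :
    -(n : K) ^ ((n : ℤ) - 3) < -2 * (n : K) ^ ((n : ℤ) - 4) ∧
      -2 * (n : K) ^ ((n : ℤ) - 4) < 0 ∧
      0 < 2 * ((n : K) - 2) * (n : K) ^ ((n : ℤ) - 3) := by
  have hn' : (2 : K) < n := by exact_mod_cast hn
  have hpos : (0 : K) < n := two_pos.trans hn'
  have hc : 0 < (n : K) ^ ((n : ℤ) - 4) := zpow_pos hpos _
  rw [show (n : ℤ) - 3 = n - 4 + 1 by ring, zpow_add_one₀ hpos.ne']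
  refine ⟨by nlinarith, by linarith, ?_⟩
  exact mul_pos (mul_pos two_pos (sub_pos.2 hn')) (mul_pos hc hpos)

end Spectrum

end CompleteGraphHessian

open CompleteGraphHessian

theorem mainTheorem1_general {K V : Type*} [Field K] [LinearOrder K] [IsStrictOrderedRing K]
    [Fintype V] [DecidableEq V] {n : ℕ} (hn : 3 ≤ n) (hV : Fintype.card V = n)
    {H : Matrix (⊤ : SimpleGraph V).edgeSet (⊤ : SimpleGraph V).edgeSet K}
    (hH : H = (⊤ : SimpleGraph V).hessianMatrixAtOne K) :
    (∀ μ : K, Module.End.HasEigenvalue (Matrix.toLin' H) μ ↔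
      (4 ≤ n ∧ μ = -2 * (n : K) ^ ((n : ℤ) - 4)) ∨
        μ = -(n : K) ^ ((n : ℤ) - 3) ∨
        μ = 2 * ((n : K) - 2) * (n : K) ^ ((n : ℤ) - 3)) ∧
    Module.finrank K (Module.End.eigenspace (Matrix.toLin' H)
      (-2 * (n : K) ^ ((n : ℤ) - 4))) = n.choose 2 - n ∧
    Module.finrank K (Module.End.eigenspace (Matrix.toLin' H)
      (-(n : K) ^ ((n : ℤ) - 3))) = n - 1 ∧
    Module.finrank K (Module.End.eigenspace (Matrix.toLin' H)
      (2 * ((n : K) - 2) * (n : K) ^ ((n : ℤ) - 3))) = 1 ∧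
    H.IsSymm ∧
    Multiset.card H.charpoly.roots = n.choose 2 ∧
    Multiset.card (H.charpoly.roots.filter (fun μ : K => 0 < μ)) = 1 ∧
    Multiset.card (H.charpoly.roots.filter (fun μ : K => μ < 0)) = n.choose 2 - 1 := by
  have hsymm : H.IsSymm := hH ▸ isSymm_hessianMatrixAtOne K _
  have hroots := hH ▸ roots_charpoly_hessianMatrixAtOne_top (K := K) hn hV
  have hdim := finrank_eigenspace_toLin'_of_isSymm hsymm
  have hle := le_choose_two hn
  obtain ⟨h₂₁, h₁, h₃⟩ := eigenvalues_strictly_ordered (K := K) hn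
  generalize -2 * (n : K) ^ ((n : ℤ) - 4) = μ₁, -(n : K) ^ ((n : ℤ) - 3) = μ₂,
    2 * ((n : K) - 2) * (n : K) ^ ((n : ℤ) - 3) = μ₃ at *
  have h₂ := h₂₁.trans h₁
  refine ⟨fun μ => ?_, ?_, ?_, ?_, hsymm, ?_, ?_, ?_⟩
  · rw [hasEigenvalue_toLin'_iff_mem_roots_charpoly, hroots]
    simp only [Multiset.mem_add, Multiset.mem_replicate, Multiset.mem_singleton, or_assoc,
      Nat.sub_ne_zero_iff_lt, lt_choose_two_iff, show 1 < n by lia, true_and]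
  · simp [hdim, hroots, Multiset.count_replicate, h₂₁.ne, (h₁.trans h₃).ne]
  · simp [hdim, hroots, Multiset.count_replicate, h₂₁.ne', (h₂.trans h₃).ne]
  · simp [hdim, hroots, Multiset.count_replicate, (h₁.trans h₃).ne, (h₂.trans h₃).ne]
  · rw [hroots, Multiset.card_add, Multiset.card_add, Multiset.card_replicate,
      Multiset.card_replicate, Multiset.card_singleton]
    lia
  · simp [hroots, filter_replicate, Multiset.filter_singleton, h₁.le.not_gt, h₂.le.not_gt, h₃]
  · have : n.choose 2 - n + (n - 1) = n.choose 2 - 1 := by lia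
    simpa [hroots, filter_replicate, Multiset.filter_singleton, h₁, h₂, h₃.le.not_gt]

theorem mainTheorem1 (n : ℕ) (hn : 3 ≤ n)
    (H : Matrix (⊤ : SimpleGraph (Fin n)).edgeSet (⊤ : SimpleGraph (Fin n)).edgeSet ℝ)
    (hH : H = (⊤ : SimpleGraph (Fin n)).hessianMatrixAtOne ℝ) :
    -- the list of eigenvalues; the first one has multiplicity `0` for `n = 3`
    (∀ μ : ℝ, Module.End.HasEigenvalue (Matrix.toLin' H) μ ↔
      (4 ≤ n ∧ μ = -2 * (n : ℝ) ^ ((n : ℤ) - 4)) ∨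
        μ = -(n : ℝ) ^ ((n : ℤ) - 3) ∨
        μ = 2 * ((n : ℝ) - 2) * (n : ℝ) ^ ((n : ℤ) - 3)) ∧
    -- the dimensions of the eigenspaces
    Module.finrank ℝ (Module.End.eigenspace (Matrix.toLin' H)
      (-2 * (n : ℝ) ^ ((n : ℤ) - 4))) = n.choose 2 - n ∧
    Module.finrank ℝ (Module.End.eigenspace (Matrix.toLin' H)
      (-(n : ℝ) ^ ((n : ℤ) - 3))) = n - 1 ∧
    Module.finrank ℝ (Module.End.eigenspace (Matrix.toLin' H)
      (2 * ((n : ℝ) - 2) * (n : ℝ) ^ ((n : ℤ) - 3))) = 1 ∧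
    -- `H` is symmetric and has Lorentzian signature: of its `n.choose 2` eigenvalues, counted with
    -- multiplicity, one is positive and the others are negative
    H.IsSymm ∧
    Multiset.card H.charpoly.roots = n.choose 2 ∧
    Multiset.card (H.charpoly.roots.filter (fun μ : ℝ => 0 < μ)) = 1 ∧
    Multiset.card (H.charpoly.roots.filter (fun μ : ℝ => μ < 0)) = n.choose 2 - 1 :=
  mainTheorem1_general hn (Fintype.card_fin n) hH
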